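/- Let $R$ be an associative ring with unity and let $X$ be a (possibly unbounded) chain complex of left $R$-modules. Module means left $R$-module, and all complexes are $\mathbb{Z}$-indexed chain complexes of left $R$-modules. A complex $P$ is called DG-projective if every $P_n$ is projective and $\operatorname{Hom}_R(P,Y)$ is exact for every exact complex $Y$; a DG-projective resolution of $X$ is a quasi-isomorphism $\pi\colon P\to X$ with $P$ DG-projective. A totally acyclic (respectively, totally $\mathcal{F}$-acyclic) complex is an exact complex $T$ of projective modules such that $\operatorname{Hom}_R(T,Q)$ is exact for every projective (respectively, every flat) module $Q$. A complete resolution (respectively, $\mathcal{F}$-complete resolution) of $X$ is a diagram of morphisms of complexes $T\xrightarrow{\tau}P\xrightarrow{\pi}X$ in which $\pi$ is a DG-projective resolution of $X$, $T$ is totally acyclic (respectively, totally $\mathcal{F}$-acyclic), and $\tau_i$ is bijective for all $i\gg 0$. The projective, Gorenstein projective and Ding projective dimensions of $X$ are defined as the following infima in $\{-\infty\}\cup\mathbb{Z}\cup\{\infty\}$ (where $\inf\emptyset=\infty$): - $\operatorname{pd}_R(X)=\inf\{n\in\mathbb{Z}\mid X$ has a DG-projective resolution $P\to X$ with $P_i=0$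 for all $i>n\}$; - $\operatorname{Gpd}_R(X)=\inf\{n\in\mathbb{Z}\mid X$ has a complete resolution $T\xrightarrow{\tau}P\xrightarrow{\pi}X$ with $\tau_i$ bijective for all $i\ge n\}$; - $\operatorname{Dpd}_R(X)=\inf\{n\in\mathbb{Z}\mid X$ has an $\mathcal{F}$-complete resolution $T\xrightarrow{\tau}P\xrightarrow{\pi}X$ with $\tau_i$ bijective for all $i\ge n\}$. Then $$\operatorname{Gpd}_R(X)\le\operatorname{Dpd}_R(X)\le\operatorname{pd}_R(X),$$ and if $\operatorname{pd}_R(X)<\infty$, then $\operatorname{Gpd}_R(X)=\operatorname{Dpd}_R(X)=\operatorname{pd}_R(X)$. -/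

import Mathlib

open CategoryTheory

universe u v w

namespace DingDimension

section Flat

open scoped TensorProduct

variable (R : Type u) [Ring R]

/-- The subgroup of `M ⊗ N` (tensor product of abelian groups) generated by the elements
`(m r) ⊗ n - m ⊗ (r n)`, for a right `R`-module `M` and a left `R`-module `N`.
Right `R`-modules are modules over the opposite ring. -/
def balancedSubgroup (M : Type v) [AddCommGroup M] [Module Rᵐᵒᵖ M]
    (N : Type w) [AddCommGroup N] [Module R N] : AddSubgroup (M ⊗[ℤ] N) :=
  AddSubgroup.closure
    {t | ∃ (m : M) (r : R) (n : N), t = (MulOpposite.op r • m) ⊗ₜ[ℤ] n - m ⊗ₜ[ℤ] (r • n)}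

/-- The tensor product `M ⊗_R N` of a right `R`-module `M` and a left `R`-module `N` over the
(not necessarily commutative) ring `R`; it is an abelian group. -/
abbrev RingTensor (M : Type v) [AddCommGroup M] [Module Rᵐᵒᵖ M]
    (N : Type w) [AddCommGroup N] [Module R N] : Type (max v w) :=
  (M ⊗[ℤ] N) ⧸ balancedSubgroup R M N

/-- The homomorphism `f ⊗_R N : M ⊗_R N → M' ⊗_R N`, `m ⊗ n ↦ f m ⊗ n`, induced by a
homomorphism `f : M → M'` of right `R`-modules. -/
noncomputable def RingTensor.map {M M' : Type v} [AddCommGroup M] [Module Rᵐᵒᵖ M]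
    [AddCommGroup M'] [Module Rᵐᵒᵖ M'] (f : M →ₗ[Rᵐᵒᵖ] M')
    (N : Type w) [AddCommGroup N] [Module R N] : RingTensor R M N →+ RingTensor R M' N :=
  QuotientAddGroup.map (balancedSubgroup R M N) (balancedSubgroup R M' N)
    (f.toAddMonoidHom.toIntLinearMap.rTensor N).toAddMonoidHom (by
      refine (AddSubgroup.closure_le _).2 ?_
      rintro _ ⟨m, r, n, rfl⟩
      refine AddSubgroup.subset_closure ⟨f m, r, n, ?_⟩
      simp)

/-- A left `R`-module `N` is flat if `- ⊗_R N` preserves injectivity of homomorphisms of right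
`R`-modules. -/
def IsFlat (N : Type w) [AddCommGroup N] [Module R N] : Prop :=
  ∀ (M M' : Type u) [AddCommGroup M] [Module Rᵐᵒᵖ M] [AddCommGroup M'] [Module Rᵐᵒᵖ M']
    (f : M →ₗ[Rᵐᵒᵖ] M'), Function.Injective f → Function.Injective (RingTensor.map R f N)

end Flat

section Complexes

variable {R : Type u} [Ring R]

/-- The complex `Hom_R(P, X)` of abelian groups, for complexes `P` and `X` of left `R`-modules.
It is Mathlib's complex of homomorphisms, after rewriting the chain complexes `P` and `X` as
cochain complexes by `X^n = X_{-n}`. -/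
noncomputable abbrev homComplex (P X : ChainComplex (ModuleCat.{w} R) ℤ) :
    CochainComplex AddCommGrpCat ℤ :=
  CochainComplex.HomComplex
    ((ChainComplex.cochainComplexEquivalence (ModuleCat.{w} R)).functor.obj P)
    ((ChainComplex.cochainComplexEquivalence (ModuleCat.{w} R)).functor.obj X)

/-- A complex `P` is DG-projective if all `P_n` are projective and `Hom_R(P, X)` is exact for
every exact complex `X`. -/
structure IsDGProjective (P : ChainComplex (ModuleCat.{w} R) ℤ) : Prop where
  projective : ∀ n : ℤ, Module.Projective R (P.X n)
  hom_exact : ∀ X : ChainComplex (ModuleCat.{w} R) ℤ, X.Acyclic → (homComplex P X).Acyclic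

/-- A DG-projective resolution of `X` is a quasi-isomorphism `P ⟶ X` with `P` DG-projective. -/
structure IsDGProjectiveResolution {P X : ChainComplex (ModuleCat.{w} R) ℤ} (π : P ⟶ X) :
    Prop where
  dgProjective : IsDGProjective P
  quasiIso : QuasiIso π

/-- The complex `Hom_R(T, F)`, with terms `Hom_R(T_n, F)`, is exact: every `f : T_n → F` with
`f ∘ d_{n+1} = 0` is of the form `g ∘ d_n` with `g : T_{n-1} → F`. -/
def HomExact (T : ChainComplex (ModuleCat.{w} R) ℤ) (F : ModuleCat.{w} R) : Prop :=
  ∀ (n : ℤ) (f : T.X n ⟶ F), T.d (n + 1) n ≫ f = 0 →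
    ∃ g : T.X (n - 1) ⟶ F, T.d n (n - 1) ≫ g = f

/-- A totally acyclic complex: an exact complex `T` of projective modules such that
`Hom_R(T, Q)` is exact for every projective module `Q`. -/
structure IsTotallyAcyclic (T : ChainComplex (ModuleCat.{w} R) ℤ) : Prop where
  projective : ∀ n : ℤ, Module.Projective R (T.X n)
  exact : T.Acyclic
  hom_exact : ∀ Q : ModuleCat.{w} R, Module.Projective R Q → HomExact T Q

/-- A totally `𝓕`-acyclic complex, `𝓕` the class of flat modules: an exact complex `T` of
projective modules such that `Hom_R(T, F)` is exact for every flat module `F`. -/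
structure IsTotallyFAcyclic (T : ChainComplex (ModuleCat.{w} R) ℤ) : Prop where
  projective : ∀ n : ℤ, Module.Projective R (T.X n)
  exact : T.Acyclic
  hom_exact : ∀ F : ModuleCat.{w} R, IsFlat R F → HomExact T F

/-- A complete resolution of `X` is a diagram `T ⟶ P ⟶ X` with `T` totally acyclic,
`π : P ⟶ X` a DG-projective resolution and `τ_i` bijective for all `i ≫ 0`. -/
structure IsCompleteResolution {T P X : ChainComplex (ModuleCat.{w} R) ℤ}
    (τ : T ⟶ P) (π : P ⟶ X) : Prop where
  resolution : IsDGProjectiveResolution π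
  totallyAcyclic : IsTotallyAcyclic T
  eventually_bijective : ∃ m : ℤ, ∀ i : ℤ, m ≤ i → Function.Bijective (τ.f i)

/-- An `𝓕`-complete resolution of `X` is a diagram `T ⟶ P ⟶ X` with `T` totally `𝓕`-acyclic,
`π : P ⟶ X` a DG-projective resolution and `τ_i` bijective for all `i ≫ 0`. -/
structure IsFCompleteResolution {T P X : ChainComplex (ModuleCat.{w} R) ℤ}
    (τ : T ⟶ P) (π : P ⟶ X) : Prop where
  resolution : IsDGProjectiveResolution π
  totallyFAcyclic : IsTotallyFAcyclic T
  eventually_bijective : ∃ m : ℤ, ∀ i : ℤ, m ≤ i → Function.Bijective (τ.f i)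

/-- The infimum in `{-∞} ∪ ℤ ∪ {∞}` of a set of integers: `∞` for the empty set and `-∞` for a
set that is not bounded below. -/
noncomputable def extInf (S : Set ℤ) : EInt :=
  sInf (WithBotTop.coe '' S)

/-- The projective dimension of a complex `X`: the infimum of the integers `n` such that `X` has
a DG-projective resolution `P ⟶ X` with `P_i = 0` for all `i > n`. -/
noncomputable def pd (X : ChainComplex (ModuleCat.{w} R) ℤ) : EInt :=
  extInf {n | ∃ (P : ChainComplex (ModuleCat.{w} R) ℤ) (π : P ⟶ X),
    IsDGProjectiveResolution π ∧ ∀ i : ℤ, n < i → Limits.IsZero (P.X i)}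

/-- The Gorenstein projective dimension of a complex `X`. -/
noncomputable def Gpd (X : ChainComplex (ModuleCat.{w} R) ℤ) : EInt :=
  extInf {n | ∃ (T P : ChainComplex (ModuleCat.{w} R) ℤ) (τ : T ⟶ P) (π : P ⟶ X),
    IsCompleteResolution τ π ∧ ∀ i : ℤ, n ≤ i → Function.Bijective (τ.f i)}

/-- The Ding projective dimension of a complex `X`. -/
noncomputable def Dpd (X : ChainComplex (ModuleCat.{w} R) ℤ) : EInt :=
  extInf {n | ∃ (T P : ChainComplex (ModuleCat.{w} R) ℤ) (τ : T ⟶ P) (π : P ⟶ X),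
    IsFCompleteResolution τ π ∧ ∀ i : ℤ, n ≤ i → Function.Bijective (τ.f i)}

end Complexes

end DingDimension

namespace DingDimension

section Flat

open scoped TensorProduct

variable {R : Type u} [Ring R]

/-- The map `M ⊗_R N → N →₀ M`, `m ⊗ n ↦ (a ↦ m s(n)(a))`, induced by an `R`-linear map
`s : N → N →₀ R`. -/
noncomputable def RingTensor.toFinsupp {N : Type w} [AddCommGroup N] [Module R N]
    (s : N →ₗ[R] N →₀ R) (M : Type v) [AddCommGroup M] [Module Rᵐᵒᵖ M] :
    RingTensor R M N →+ (N →₀ M) :=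
  QuotientAddGroup.lift (balancedSubgroup R M N)
    (TensorProduct.liftAddHom
      { toFun := fun m =>
          { toFun := fun n => (s n).mapRange (fun r => MulOpposite.op r • m) (by simp)
            map_zero' := by ext; simp
            map_add' := fun n n' => by ext; simp [add_smul] }
        map_zero' := by ext; simp
        map_add' := fun m m' => by ext; simp }
      (fun k m n => by ext a; simp [mul_smul, Int.cast_smul_eq_zsmul])) (by
      refine (AddSubgroup.closure_le _).2 ?_
      rintro _ ⟨m, r, n, rfl⟩
      simp only [SetLike.mem_coe, AddMonoidHom.mem_ker, map_sub, sub_eq_zero]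
      ext a
      simp [mul_smul])

/-- The map `(N →₀ M) → M ⊗_R N` sending `single a m` to `m ⊗ a`. -/
noncomputable def RingTensor.ofFinsupp (R : Type u) [Ring R]
    (N : Type w) [AddCommGroup N] [Module R N]
    (M : Type v) [AddCommGroup M] [Module Rᵐᵒᵖ M] :
    (N →₀ M) →+ RingTensor R M N :=
  Finsupp.liftAddHom fun a =>
    (QuotientAddGroup.mk' (balancedSubgroup R M N)).comp
      ((TensorProduct.mk ℤ M N).flip a).toAddMonoidHom

lemma RingTensor.mk_op_smul_tmul {N : Type w} [AddCommGroup N] [Module R N]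
    {M : Type v} [AddCommGroup M] [Module Rᵐᵒᵖ M] (m : M) (r : R) (n : N) :
    (QuotientAddGroup.mk ((MulOpposite.op r • m) ⊗ₜ[ℤ] n) : RingTensor R M N) =
      QuotientAddGroup.mk (m ⊗ₜ[ℤ] (r • n)) := by
  rw [QuotientAddGroup.eq_iff_sub_mem]
  exact AddSubgroup.subset_closure ⟨m, r, n, rfl⟩

lemma RingTensor.ofFinsupp_toFinsupp {N : Type w} [AddCommGroup N] [Module R N]
    (s : N →ₗ[R] N →₀ R) (hs : ∀ n, Finsupp.linearCombination R id (s n) = n)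
    {M : Type v} [AddCommGroup M] [Module Rᵐᵒᵖ M] (x : RingTensor R M N) :
    ofFinsupp R N M (toFinsupp s M x) = x := by
  obtain ⟨t, rfl⟩ := QuotientAddGroup.mk_surjective x
  induction t using TensorProduct.induction_on with
  | zero => simp
  | add t t' h h' => rw [QuotientAddGroup.mk_add, map_add, map_add, h, h']
  | tmul m n =>
    have key : ofFinsupp R N M (toFinsupp s M (QuotientAddGroup.mk (m ⊗ₜ[ℤ] n))) =
        (s n).sum fun a r =>
          (QuotientAddGroup.mk ((MulOpposite.op r • m) ⊗ₜ[ℤ] a) : RingTensor R M N) := by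
      change (((s n).mapRange (fun r => MulOpposite.op r • m) (by simp)).sum fun a m' =>
        (QuotientAddGroup.mk (m' ⊗ₜ[ℤ] a) : RingTensor R M N)) = _
      exact Finsupp.sum_mapRange_index (by simp)
    rw [key]
    conv_rhs => rw [← hs n, Finsupp.linearCombination_apply]
    simp only [mk_op_smul_tmul, Finsupp.sum, id, TensorProduct.tmul_sum]
    exact (map_sum (QuotientAddGroup.mk' (balancedSubgroup R M N)) _ _).symm

lemma RingTensor.toFinsupp_map {N : Type w} [AddCommGroup N] [Module R N]
    (s : N →ₗ[R] N →₀ R) {M M' : Type v} [AddCommGroup M] [Module Rᵐᵒᵖ M]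
    [AddCommGroup M'] [Module Rᵐᵒᵖ M'] (f : M →ₗ[Rᵐᵒᵖ] M') (x : RingTensor R M N) :
    toFinsupp s M' (RingTensor.map R f N x) =
      (toFinsupp s M x).mapRange f (map_zero f) := by
  obtain ⟨t, rfl⟩ := QuotientAddGroup.mk_surjective x
  induction t using TensorProduct.induction_on with
  | zero => ext; simp
  | add t t' h h' =>
    rw [QuotientAddGroup.mk_add, map_add, map_add, h, h', map_add, Finsupp.mapRange_add
      (map_add f)]
  | tmul m n =>
    ext a
    change MulOpposite.op (s n a) • f m = f (MulOpposite.op (s n a) • m)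
    rw [map_smul]

/-- Projective modules are flat. -/
theorem IsFlat.of_projective (N : Type w) [AddCommGroup N] [Module R N]
    [Module.Projective R N] : IsFlat R N := by
  obtain ⟨s, hs⟩ := Module.Projective.out (R := R) (P := N)
  intro M M' _ _ _ _ f hf
  rw [injective_iff_map_eq_zero]
  intro x hx
  have h := RingTensor.toFinsupp_map s f x
  rw [hx, map_zero, eq_comm] at h
  have h0 : RingTensor.toFinsupp s M x = 0 :=
    Finsupp.mapRange_injective f (map_zero f) hf (by rw [h, Finsupp.mapRange_zero])
  rw [← RingTensor.ofFinsupp_toFinsupp s hs x, h0, map_zero]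

end Flat

open Limits CochainComplex.HomComplex

section Complexes

variable {R : Type u} [Ring R]

lemma extInf_mono {S T : Set ℤ} (h : S ⊆ T) : extInf T ≤ extInf S :=
  sInf_le_sInf (Set.image_mono h)

lemma nonempty_of_extInf_ne_top {S : Set ℤ} (h : extInf S ≠ ⊤) : S.Nonempty := by
  by_contra hS
  rw [Set.not_nonempty_iff_eq_empty] at hS
  simp [extInf, hS] at h

/-- A contractible complex stays exact after applying `Hom_R(-, F)`. -/
lemma HomExact.of_homotopy {T : ChainComplex (ModuleCat.{w} R) ℤ} (h : Homotopy (𝟙 T) 0)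
    (F : ModuleCat.{w} R) : HomExact T F := by
  intro n f hf
  have hc := h.comm n
  rw [dNext_eq _ (show (ComplexShape.down ℤ).Rel n (n - 1) by simp),
    prevD_eq _ (show (ComplexShape.down ℤ).Rel (n + 1) n by simp)] at hc
  refine ⟨h.hom (n - 1) n ≫ f, ?_⟩
  have := congrArg (· ≫ f) hc
  simpa [hf] using this.symm

lemma acyclic_of_homotopy {T : ChainComplex (ModuleCat.{w} R) ℤ} (h : Homotopy (𝟙 T) 0) :
    T.Acyclic := by
  intro n
  rw [HomologicalComplex.exactAt_iff_isZero_homology, IsZero.iff_id_eq_zero]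
  have := h.homologyMap_eq n
  simpa using this

/-- The complex `0 → M → M → 0` is contractible. -/
noncomputable def doubleIdHomotopy (M : ModuleCat.{w} R) {i j : ℤ}
    (hij : (ComplexShape.down ℤ).Rel i j) (h : i ≠ j) :
    Homotopy (𝟙 (HomologicalComplex.double (𝟙 M) hij)) 0 :=
  (Homotopy.ofEq (by
    have hj : j = i - 1 := by simp at hij; lia
    ext : 1
    · rw [Homotopy.nullHomotopicMap'_f (k₂ := i + 1) (k₁ := i) (k₀ := j) (by simp) hij,
        dif_pos ⟨rfl, rfl⟩, dif_neg (by lia), HomologicalComplex.double_d _ _ h]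
      simp
    · rw [Homotopy.nullHomotopicMap'_f (k₂ := i) (k₁ := j) (k₀ := j - 1) hij (by simp),
        dif_neg (by lia), dif_pos ⟨rfl, rfl⟩, HomologicalComplex.double_d _ _ h]
      simp)).trans (Homotopy.nullHomotopy' (fun a b _ =>
      if hab : a = j ∧ b = i then
        eqToHom (by rw [hab.1]) ≫ (HomologicalComplex.doubleXIso₁ (𝟙 M) hij h).hom ≫
          (HomologicalComplex.doubleXIso₀ (𝟙 M) hij).inv ≫ eqToHom (by rw [hab.2])
      else 0))

/-- The functor rewriting chain complexes as cochain complexes. -/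
noncomputable abbrev toCochain :
    ChainComplex (ModuleCat.{w} R) ℤ ⥤ CochainComplex (ModuleCat.{w} R) ℤ :=
  (ChainComplex.cochainComplexEquivalence (ModuleCat.{w} R)).functor

lemma homComplex_acyclic_iff (K L : CochainComplex (ModuleCat.{w} R) ℤ) :
    (CochainComplex.HomComplex K L).Acyclic ↔
      ∀ (n : ℤ) (z : Cochain K L n), δ n (n + 1) z = 0 →
        ∃ y : Cochain K L (n - 1), δ (n - 1) n y = z := by
  refine forall_congr' fun n => ?_
  rw [HomologicalComplex.exactAt_iff' _ (n - 1) n (n + 1) (by simp) (by simp),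
    ShortComplex.ab_exact_iff]
  rfl

lemma acyclic_toCochain_inverse {L : CochainComplex (ModuleCat.{w} R) ℤ} (hL : L.Acyclic) :
    ((ChainComplex.cochainComplexEquivalence (ModuleCat.{w} R)).inverse.obj L).Acyclic := by
  intro n
  have h := hL (-n)
  rw [HomologicalComplex.exactAt_iff' _ (-(n + 1)) (-n) (-(n - 1)) (by simp; lia) (by simp; lia)]
    at h
  rw [HomologicalComplex.exactAt_iff' _ (n + 1) n (n - 1) (by simp) (by simp)]
  exact h

lemma quasiIso_toCochain {P X : ChainComplex (ModuleCat.{w} R) ℤ} (π : P ⟶ X) [QuasiIso π] :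
    QuasiIso (toCochain.map π) where
  quasiIsoAt n := by
    have h : QuasiIsoAt π (-n) := inferInstance
    rw [quasiIsoAt_iff' _ (-(n - 1)) (-n) (-(n + 1)) (by simp; lia) (by simp; lia)] at h
    rw [quasiIsoAt_iff' _ (n - 1) n (n + 1) (by simp) (by simp)]
    exact h

lemma IsDGProjective.isKProjective {P : ChainComplex (ModuleCat.{w} R) ℤ}
    (hP : IsDGProjective P) : (toCochain.obj P).IsKProjective where
  nonempty_homotopy_zero {L} f hL := by
    let e := ChainComplex.cochainComplexEquivalence (ModuleCat.{w} R)
    have h := (homComplex_acyclic_iff _ _).1 (hP.hom_exact _ (acyclic_toCochain_inverse hL)) 0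
      (Cochain.ofHom (f ≫ e.counitIso.inv.app L)) (by simp)
    obtain ⟨y, hy⟩ := h
    have ho : Homotopy (f ≫ e.counitIso.inv.app L) 0 :=
      (Cochain.equivHomotopy _ _).symm ⟨y, by simpa using hy.symm⟩
    exact ⟨(Homotopy.ofEq (by simp)).trans ((ho.compRight (e.counitIso.hom.app L)).trans
      (Homotopy.ofEq (by simp)))⟩

/-- Homotopies descend along the passage from chain to cochain complexes. -/
noncomputable def homotopyOfToCochain {P Q : ChainComplex (ModuleCat.{w} R) ℤ} {f g : P ⟶ Q}
    (h : Homotopy (toCochain.map f) (toCochain.map g)) : Homotopy f g :=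
  let k (a b : ℤ) : P.X (-a) ⟶ Q.X (-b) := h.hom a b
  { hom i j := (P.XIsoOfEq (by simp)).hom ≫ k (-i) (-j) ≫ (Q.XIsoOfEq (by simp)).hom
    zero i j hij := by
      have : k (-i) (-j) = 0 := h.zero _ _ (by simp at hij ⊢; lia)
      rw [this, Limits.zero_comp, Limits.comp_zero]
    comm i := by
      obtain ⟨n, rfl⟩ : ∃ n, i = -n := ⟨-i, by simp⟩
      have hk (a b a' b' : ℤ) (ha : a = a') (hb : b = b') :
          k a b = (P.XIsoOfEq (by simp [ha])).hom ≫ k a' b' ≫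
            (Q.XIsoOfEq (by simp [hb])).hom := by
        subst ha hb
        simp
      have hc := h.comm n
      rw [dNext_eq _ (show (ComplexShape.up ℤ).Rel n (n + 1) by simp),
        prevD_eq _ (show (ComplexShape.up ℤ).Rel (n - 1) n by simp)] at hc
      rw [dNext_eq _ (show (ComplexShape.down ℤ).Rel (-n) (-(n + 1)) by simp),
        prevD_eq _ (show (ComplexShape.down ℤ).Rel (-(n - 1)) (-n) by simp; lia),
        hk (- -(n + 1)) (- -n) (n + 1) n (by simp) (by simp),
        hk (- -n) (- -(n - 1)) n (n - 1) (by simp) (by simp)]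
      refine Eq.trans (b := P.d (-n) (-(n + 1)) ≫ k (n + 1) n +
        k n (n - 1) ≫ Q.d (-(n - 1)) (-n) + g.f (-n)) hc ?_
      simp }

/-- Two DG-projective resolutions of the same complex are homotopy equivalent. -/
lemma exists_comp_homotopy_id {P P' X : ChainComplex (ModuleCat.{w} R) ℤ} {π : P ⟶ X}
    {π' : P' ⟶ X} (h : IsDGProjectiveResolution π) (h' : IsDGProjectiveResolution π') :
    ∃ (f : P ⟶ P') (g : P' ⟶ P), Nonempty (Homotopy (f ≫ g) (𝟙 P)) := by
  let := HasDerivedCategory.standard (ModuleCat.{w} R)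
  have := h.dgProjective.isKProjective
  have := h'.dgProjective.isKProjective
  have := h.quasiIso
  have := h'.quasiIso
  have := quasiIso_toCochain π
  have := quasiIso_toCochain π'
  let e := DerivedCategory.quotientCompQhIso (ModuleCat.{w} R)
  let q : DerivedCategory.Q.obj (toCochain.obj P) ≅ DerivedCategory.Q.obj (toCochain.obj P') :=
    asIso (DerivedCategory.Q.map (toCochain.map π)) ≪≫
      (asIso (DerivedCategory.Q.map (toCochain.map π'))).symm
  obtain ⟨u, hu⟩ := (CochainComplex.IsKProjective.Qh_map_bijective _ _).surjective
    (e.hom.app _ ≫ q.hom ≫ e.inv.app _)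
  obtain ⟨v, hv⟩ := (CochainComplex.IsKProjective.Qh_map_bijective _ _).surjective
    (e.hom.app _ ≫ q.inv ≫ e.inv.app _)
  have huv : u ≫ v = 𝟙 _ := (CochainComplex.IsKProjective.Qh_map_bijective _ _).injective (by
    simp [hu, hv])
  obtain ⟨u, rfl⟩ := (HomotopyCategory.quotient _ _).map_surjective u
  obtain ⟨v, rfl⟩ := (HomotopyCategory.quotient _ _).map_surjective v
  obtain ⟨f, rfl⟩ := toCochain.map_surjective u
  obtain ⟨g, rfl⟩ := toCochain.map_surjective v
  exact ⟨f, g, ⟨homotopyOfToCochain (HomotopyCategory.homotopyOfEq _ _ (by simpa using huv))⟩⟩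

/-- A retract of a DG-projective complex is DG-projective. -/
lemma IsDGProjective.of_retract {P Q : ChainComplex (ModuleCat.{w} R) ℤ}
    (hP : IsDGProjective P) (i : Q ⟶ P) (r : P ⟶ Q) (hir : i ≫ r = 𝟙 Q) :
    IsDGProjective Q where
  projective n := by
    have := hP.projective n
    refine Module.Projective.of_split (i.f n).hom (r.f n).hom ?_
    rw [← ModuleCat.hom_comp, ← HomologicalComplex.comp_f, hir]
    rfl
  hom_exact X hX := by
    rw [homComplex_acyclic_iff]
    intro n z hz
    obtain ⟨y, hy⟩ := (homComplex_acyclic_iff _ _).1 (hP.hom_exact X hX) n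
      ((Cochain.ofHom (toCochain.map r)).comp z (zero_add n)) (by simp [hz])
    refine ⟨(Cochain.ofHom (toCochain.map i)).comp y (zero_add _), ?_⟩
    rw [δ_ofHom_comp, hy, ← Cochain.comp_assoc_of_first_is_zero_cochain, ← Cochain.ofHom_comp,
      ← Functor.map_comp, hir, CategoryTheory.Functor.map_id, Cochain.id_comp]

/-- The endomorphism `d h + h d` of `P` given by a family of maps `h_i : P_i ⟶ P_{i+1}`. -/
noncomputable def nullMap {P : ChainComplex (ModuleCat.{w} R) ℤ}
    (h : ∀ i : ℤ, P.X i ⟶ P.X (i + 1)) : P ⟶ P :=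
  Homotopy.nullHomotopicMap' fun i j hij => h i ≫ (P.XIsoOfEq (by simpa using hij)).hom

lemma nullMap_f {P : ChainComplex (ModuleCat.{w} R) ℤ} (h : ∀ i : ℤ, P.X i ⟶ P.X (i + 1))
    (i : ℤ) : (nullMap h).f (i + 1) = P.d (i + 1) i ≫ h i + h (i + 1) ≫ P.d (i + 1 + 1) (i + 1) := by
  rw [nullMap, Homotopy.nullHomotopicMap'_f (k₂ := i + 1 + 1) (k₁ := i + 1) (k₀ := i)
    (by simp) (by simp)]
  simp

/-- A partial contracting homotopy extends downwards through the range in which the complex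
agrees with a totally acyclic one. -/
lemma exists_nullMap_of_homExact {P : ChainComplex (ModuleCat.{w} R) ℤ} (g : ℤ)
    (hP : ∀ i : ℤ, g ≤ i → ∀ f : P.X (i + 1) ⟶ P.X (i + 1), P.d (i + 1 + 1) (i + 1) ≫ f = 0 →
      ∃ k : P.X i ⟶ P.X (i + 1), P.d (i + 1) i ≫ k = f)
    (N : ℕ) (h : ∀ i : ℤ, P.X i ⟶ P.X (i + 1))
    (hh : ∀ i : ℤ, g + N ≤ i → (nullMap h).f (i + 1) = 𝟙 _) :
    ∃ h' : ∀ i : ℤ, P.X i ⟶ P.X (i + 1), ∀ i : ℤ, g ≤ i → (nullMap h').f (i + 1) = 𝟙 _ := by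
  induction N generalizing h with
  | zero => exact ⟨h, by simpa using hh⟩
  | succ N ih =>
    obtain ⟨k, hk⟩ := hP (g + N) (by lia) (𝟙 _ - h (g + N + 1) ≫ P.d _ _) (by
      have := hh (g + N + 1) (by push_cast; lia)
      rw [nullMap_f] at this
      have := congrArg (· ≫ P.d _ (g + N + 1)) this
      simp at this
      simp [this])
    refine ih (Function.update h (g + N) k) fun i hi => ?_
    rw [nullMap_f, Function.update_of_ne (show i + 1 ≠ g + N by lia)]
    obtain rfl | hne := eq_or_ne i (g + N)
    · simp [hk]
    · rw [Function.update_of_ne hne, ← nullMap_f, hh _ (by push_cast; lia)]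

/-- A complex with a contracting homotopy in degrees above `g` has a homotopy equivalent retract
that vanishes above `g`. -/
lemma exists_retract_of_nullMap {P : ChainComplex (ModuleCat.{w} R) ℤ} (g : ℤ)
    (h : ∀ i : ℤ, P.X i ⟶ P.X (i + 1))
    (hh : ∀ i : ℤ, g ≤ i → (nullMap h).f (i + 1) = 𝟙 _) :
    ∃ (Q : ChainComplex (ModuleCat.{w} R) ℤ) (e : HomotopyEquiv Q P),
      e.hom ≫ e.inv = 𝟙 Q ∧ ∀ i, g < i → IsZero (Q.X i) := by
  let k (i : ℤ) : P.X i ⟶ P.X (i + 1) := if g ≤ i then h i else 0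
  have hk (i : ℤ) (hi : g ≤ i) : k i = h i := if_pos hi
  have hk0 (i : ℤ) (hi : i < g) : k i = 0 := if_neg (by lia)
  have h1 (i : ℤ) (hi : g ≤ i) : (nullMap k).f (i + 1) = 𝟙 _ := by
    rw [nullMap_f, hk _ hi, hk _ (by lia), ← nullMap_f, hh _ hi]
  have h0 (i : ℤ) (hi : i + 1 < g) : (nullMap k).f (i + 1) = 0 := by
    rw [nullMap_f, hk0 _ (by lia), hk0 _ hi, comp_zero, zero_comp, add_zero]
  have hidem : nullMap k ≫ nullMap k = nullMap k := by
    ext i : 1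
    obtain ⟨i, rfl⟩ : ∃ j, i = j + 1 := ⟨i - 1, by simp⟩
    rw [HomologicalComplex.comp_f]
    obtain hi | rfl | hi : i + 1 < g ∨ g = i + 1 ∨ g ≤ i := by lia
    · simp [h0 i hi]
    · have h2 := h1 (i + 1) le_rfl
      rw [nullMap_f] at h2
      have h3 := congrArg (fun t => k (i + 1) ≫ P.d _ (i + 1) ≫ k (i + 1) ≫ P.d _ (i + 1)) h2
      have h2 := congrArg (· ≫ P.d _ (i + 1)) h2
      simp only [Preadditive.add_comp, Category.assoc, P.d_comp_d, comp_zero, add_zero,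
        Category.id_comp] at h2
      rw [nullMap_f, hk0 i (by lia)]
      simp [h2]
    · simp [h1 i hi]
  obtain ⟨Q, s, r, hsr, hrs⟩ := IsIdempotentComplete.idempotents_split P (𝟙 P - nullMap k)
    (by simp [hidem])
  refine ⟨Q, ⟨s, r, Homotopy.ofEq hsr, ?_⟩, hsr, fun i hi => ?_⟩
  · exact (Homotopy.ofEq hrs).trans (Homotopy.equivSubZero.symm
      ((Homotopy.ofEq (sub_sub_cancel _ _)).trans (Homotopy.nullHomotopy' _))).symm
  · obtain ⟨i, rfl⟩ : ∃ j, i = j + 1 := ⟨i - 1, by simp⟩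
    have h2 := HomologicalComplex.congr_hom hrs (i + 1)
    have h3 := HomologicalComplex.congr_hom hsr (i + 1)
    simp [h1 i (by lia)] at h2 h3
    rw [IsZero.iff_id_eq_zero]
    calc 𝟙 (Q.X (i + 1)) = (s.f (i + 1) ≫ r.f (i + 1)) ≫ s.f (i + 1) ≫ r.f (i + 1) := by
          rw [h3, Category.comp_id]
      _ = s.f (i + 1) ≫ (r.f (i + 1) ≫ s.f (i + 1)) ≫ r.f (i + 1) := by
          simp only [Category.assoc]
      _ = 0 := by rw [h2, zero_comp, comp_zero]

lemma IsFCompleteResolution.isCompleteResolution {T P X : ChainComplex (ModuleCat.{w} R) ℤ}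
    {τ : T ⟶ P} {π : P ⟶ X} (h : IsFCompleteResolution τ π) : IsCompleteResolution τ π where
  resolution := h.resolution
  totallyAcyclic :=
    { projective := h.totallyFAcyclic.projective
      exact := h.totallyFAcyclic.exact
      hom_exact := fun Q _ => h.totallyFAcyclic.hom_exact Q (IsFlat.of_projective Q) }
  eventually_bijective := h.eventually_bijective

/-- If `P` is concentrated in degrees at most `n`, the contractible complex `P_n = P_n` in degrees
`n` and `n - 1` completes the resolution `P ⟶ X`. -/
lemma IsDGProjectiveResolution.exists_isFCompleteResolution
    {P X : ChainComplex (ModuleCat.{w} R) ℤ} {π : P ⟶ X} (hπ : IsDGProjectiveResolution π)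
    {n : ℤ} (hn : ∀ i : ℤ, n < i → IsZero (P.X i)) :
    ∃ (T : ChainComplex (ModuleCat.{w} R) ℤ) (τ : T ⟶ P),
      IsFCompleteResolution τ π ∧ ∀ i : ℤ, n ≤ i → Function.Bijective (τ.f i) := by
  have hr : (ComplexShape.down ℤ).Rel n (n - 1) := by simp
  have hne : n ≠ n - 1 := by lia
  let T := HomologicalComplex.double (𝟙 (P.X n)) hr
  let τ : T ⟶ P := HomologicalComplex.mkHomFromDouble hr hne (𝟙 _) (P.d n (n - 1))
    (by simp) (by simp)
  have hτ (i : ℤ) (hi : n ≤ i) : Function.Bijective (τ.f i) := by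
    rw [← ConcreteCategory.isIso_iff_bijective]
    obtain rfl | hlt := hi.eq_or_lt
    · rw [HomologicalComplex.mkHomFromDouble_f₀]
      infer_instance
    · exact (isIso_of_source_target_iso_zero _
        (HomologicalComplex.isZero_double_X _ hr i (by lia) (by lia)).isoZero (hn i hlt).isoZero)
  have hc : Homotopy (𝟙 T) 0 := doubleIdHomotopy (P.X n) hr hne
  refine ⟨T, τ, ⟨hπ, ⟨fun i => ?_, acyclic_of_homotopy hc, fun F _ => .of_homotopy hc F⟩,
    n, hτ⟩, hτ⟩
  have := hπ.dgProjective.projective n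
  by_cases h0 : i = n
  · subst h0
    exact Module.Projective.of_equiv (HomologicalComplex.doubleXIso₀ _ hr).toLinearEquiv.symm
  by_cases h1 : i = n - 1
  · subst h1
    exact Module.Projective.of_equiv (HomologicalComplex.doubleXIso₁ _ hr hne).toLinearEquiv.symm
  · have := ModuleCat.subsingleton_of_isZero
      (HomologicalComplex.isZero_double_X (𝟙 (P.X n)) hr i h0 h1)
    exact inferInstanceAs (Module.Projective R (T.X i))

/-- If `X` has finite projective dimension, a complete resolution `T ⟶ P ⟶ X` with `τ_i` bijective
for `i ≥ g` yields a DG-projective resolution concentrated in degrees at most `g`. -/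
lemma IsCompleteResolution.exists_isDGProjectiveResolution
    {T P P' X : ChainComplex (ModuleCat.{w} R) ℤ} {τ : T ⟶ P} {π : P ⟶ X} {π' : P' ⟶ X}
    (h : IsCompleteResolution τ π) {g n : ℤ} (hg : ∀ i : ℤ, g ≤ i → Function.Bijective (τ.f i))
    (hπ' : IsDGProjectiveResolution π') (hn : ∀ i : ℤ, n < i → IsZero (P'.X i)) :
    ∃ (Q : ChainComplex (ModuleCat.{w} R) ℤ) (ρ : Q ⟶ X),
      IsDGProjectiveResolution ρ ∧ ∀ i : ℤ, g < i → IsZero (Q.X i) := by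
  obtain ⟨a, b, ⟨ho⟩⟩ := exists_comp_homotopy_id h.resolution hπ'
  have hiso (i : ℤ) (hi : g ≤ i) : IsIso (τ.f i) :=
    (ConcreteCategory.isIso_iff_bijective _).2 (hg i hi)
  obtain ⟨k, hk⟩ := exists_nullMap_of_homExact (P := P) g (fun i hi f hf => by
    have := hiso i hi
    have := hiso (i + 1) (by lia)
    have hT : HomExact T (P.X (i + 1)) :=
      h.totallyAcyclic.hom_exact _ (h.resolution.dgProjective.projective _)
    obtain ⟨k, hk⟩ := hT (i + 1) (τ.f (i + 1) ≫ f) (by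
      rw [← τ.comm_assoc, hf, comp_zero])
    refine ⟨inv (τ.f i) ≫ (T.XIsoOfEq (by simp)).hom ≫ k, ?_⟩
    rw [← cancel_epi (τ.f (i + 1)), ← hk, τ.comm_assoc]
    simp) (n - g).toNat (fun i => - ho.hom i (i + 1)) (fun i hi => by
      have hc := ho.comm (i + 1)
      rw [dNext_eq _ (show (ComplexShape.down ℤ).Rel (i + 1) i by simp),
        prevD_eq _ (show (ComplexShape.down ℤ).Rel (i + 1 + 1) (i + 1) by simp),
        HomologicalComplex.comp_f, (hn (i + 1) (by lia)).eq_of_tgt (a.f (i + 1)) 0,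
        zero_comp] at hc
      rw [nullMap_f, Preadditive.comp_neg, Preadditive.neg_comp, ← neg_add]
      exact neg_eq_of_add_eq_zero_right hc.symm)
  obtain ⟨Q, e, he, hQ⟩ := exists_retract_of_nullMap g k hk
  have := h.resolution.quasiIso
  exact ⟨Q, e.hom ≫ π, ⟨h.resolution.dgProjective.of_retract e.hom e.inv he, inferInstance⟩, hQ⟩

end Complexes

end DingDimension

theorem mainTheorem5 {R : Type u} [Ring R] (X : ChainComplex (ModuleCat.{max u v} R) ℤ) :
    (DingDimension.Gpd X ≤ DingDimension.Dpd X ∧ DingDimension.Dpd X ≤ DingDimension.pd X) ∧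
      (DingDimension.pd X ≠ ⊤ →
        DingDimension.Gpd X = DingDimension.Dpd X ∧
          DingDimension.Dpd X = DingDimension.pd X) := by
  have h₁ : DingDimension.Gpd X ≤ DingDimension.Dpd X := by
    refine DingDimension.extInf_mono ?_
    rintro n ⟨T, P, τ, π, h, hn⟩
    exact ⟨T, P, τ, π, h.isCompleteResolution, hn⟩
  have h₂ : DingDimension.Dpd X ≤ DingDimension.pd X := by
    refine DingDimension.extInf_mono ?_
    rintro n ⟨P, π, h, hn⟩
    obtain ⟨T, τ, hτ⟩ := h.exists_isFCompleteResolution hn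
    exact ⟨T, P, τ, π, hτ⟩
  refine ⟨⟨h₁, h₂⟩, fun hX => ?_⟩
  obtain ⟨n, P', π', h', hn⟩ := DingDimension.nonempty_of_extInf_ne_top hX
  have h₃ : DingDimension.pd X ≤ DingDimension.Gpd X := by
    refine DingDimension.extInf_mono ?_
    rintro g ⟨T, P, τ, π, h, hg⟩
    exact h.exists_isDGProjectiveResolution hg h' hn
  exact ⟨h₁.antisymm (h₂.trans h₃), h₂.antisymm (h₃.trans h₁)⟩
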